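/- Let $q$ be a prime power. All matroids are finite. For a matroid $M$ on $E$ with rank function $r$, let $L(M)$ be its lattice of flats, $\mu$ the one-variable Möbius function of $L(M)$, and $\chi(M,t)=\sum_{F\in L(M)}\mu(F)\,t^{r(E)-r(F)}\in\mathbb{Z}[t]$ its characteristic polynomial. A flat $X$ of $M$ is modular if $r(X)+r(Y)=r(X\wedge Y)+r(X\vee Y)$ for every flat $Y$, where $X\wedge Y=X\cap Y$ and $X\vee Y$ is the smallest flat containing $X\cup Y$. A simple matroid $M$ of rank $n$ on $E$ is supersolvable if there are modular flats $\varnothing=X_0\subseteq X_1\subseteq\dots\subseteq X_n=E$ with $r(X_i)=i$ for all $i$. A simple matroid $M$ on $E$ is a modular join of $M|E_1$ and $M|E_2$ over $X=E_1\cap E_2$ if $E_1,E_2$ are proper modular flats of $M$ with $E=E_1\cup E_2$. An arrangement over $\mathbb{F}_q$ is a finite set $\mathcal{A}$ of linear hyperplanes in a finite-dimensional $\mathbb{F}_q$-vector space; its linear dependence matroid $M(\mathcal{A})$ is the matroid on $\mathcal{A}$ in which $\{H_1,\dots,H_m\}$ (with the $H_i$ distinct) is independent if and only if $H_1\cap\dots\cap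 H_m$ has codimension $m$. For $k\ge 0$, the projective geometry $\mathrm{PG}(k-1,q)$ is the linear dependence matroid of the arrangement of all linear hyperplanes in $\mathbb{F}_q^k$ (the empty matroid if $k=0$). The arrangement $\mathcal{A}$ is divisionally free if $M=M(\mathcal{A})$ has a divisional flag, that is, if, with $n$ the rank and $E=\mathcal{A}$ the ground set of $M$, there are flats $\varnothing=X_0\subseteq X_1\subseteq\dots\subseteq X_n=E$ of $M$ such that $r(X_i)=i$ for $0\le i\le n$ and $\chi(M/X_{i+1},t)$ divides $\chi(M/X_i,t)$ in $\mathbb{Z}[t]$ for $0\le i<n$. Let $\mathcal{F}_q$ be the smallest class of simple matroids representable over $\mathbb{F}_q$ such that (i) every supersolvable matroid representable over $\mathbb{F}_q$ belongs to $\mathcal{F}_q$; (ii) $\mathcal{F}_q$ is closed under modular joins over projective geometries: if a simple matroid $M$ representable over $\mathbb{F}_q$ is a modular join of $M_1,M_2\in\mathcal{F}_q$ over a flat $X$ such that $M|X$ is isomorphic to $\mathrm{PG}(k-1,q)$ for some $k\ge 0$, then $M\in\mathcal{F}_q$. If $\mathcal{A}$ is an arrangement over $\mathbb{F}_q$ and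 $M(\mathcal{A})\in\mathcal{F}_q$, then $\mathcal{A}$ is divisionally free. -/

import Mathlib

namespace Matroid

variable {α β : Type*}

/-- A matroid is simple if it has no loops and no parallel pairs, i.e. every subset of the ground
set with at most two elements is independent. -/
def IsSimple (M : Matroid α) : Prop :=
  ∀ e ∈ M.E, ∀ f ∈ M.E, M.Indep {e, f}

/-- `M` is representable over the field `K`: it is the matroid of linear dependence of a family of
vectors in some `K ^ n` indexed by the ground set. -/
def IsRepresentableOver (K : Type*) [Field K] (M : Matroid α) : Prop :=
  ∃ (n : ℕ) (v : α → Fin n → K), ∀ I ⊆ M.E, (M.Indep I ↔ LinearIndepOn K v I)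

/-- Isomorphism of matroids: a bijection of the ground sets that preserves and reflects
independence. -/
def IsIsomorphicTo (M : Matroid α) (N : Matroid β) : Prop :=
  ∃ e : M.E ≃ N.E, ∀ I : Set M.E,
    M.Indep (Subtype.val '' I) ↔ N.Indep (Subtype.val '' (e '' I))

/-- A flat `X` is modular if `r(X) + r(Y) = r(X ∧ Y) + r(X ∨ Y)` for all flats `Y`; in the lattice
of flats the meet is the intersection and the join is the closure of the union. -/
def IsModularFlat (M : Matroid α) (X : Set α) : Prop :=
  M.IsFlat X ∧ ∀ Y, M.IsFlat Y →
    M.eRk X + M.eRk Y = M.eRk (X ∩ Y) + M.eRk (M.closure (X ∪ Y))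

/-- A saturated chain of flats `∅ = X 0 ⊆ X 1 ⊆ ⋯ ⊆ X n = E` with `r (X i) = i`
(in particular `n` is the rank of `M`). -/
structure IsFullFlag (M : Matroid α) (n : ℕ) (X : Fin (n + 1) → Set α) : Prop where
  isFlat : ∀ i, M.IsFlat (X i)
  first : X 0 = ∅
  last : X (Fin.last n) = M.E
  mono : Monotone X
  rank : ∀ i, M.eRk (X i) = (i : ℕ)

/-- A simple matroid is supersolvable if it has a saturated chain consisting of modular flats. -/
def IsSupersolvable (M : Matroid α) : Prop :=
  M.IsSimple ∧ ∃ (n : ℕ) (X : Fin (n + 1) → Set α),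
    M.IsFullFlag n X ∧ ∀ i, M.IsModularFlat (X i)

/-- The simple matroid `M` is the modular join of `M ↾ E₁` and `M ↾ E₂` (over `E₁ ∩ E₂`): `E₁` and
`E₂` are proper modular flats whose union is the ground set. -/
structure IsModularJoin (M : Matroid α) (E₁ E₂ : Set α) : Prop where
  isSimple : M.IsSimple
  modular_left : M.IsModularFlat E₁
  modular_right : M.IsModularFlat E₂
  proper_left : E₁ ≠ M.E
  proper_right : E₂ ≠ M.E
  union_eq : E₁ ∪ E₂ = M.E

/-- The lattice of flats, ordered by inclusion. -/
abbrev FlatLattice (M : Matroid α) : Type _ := {F : Set α // M.IsFlat F}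

instance finite_flatLattice (M : Matroid α) [M.Finite] : Finite M.FlatLattice :=
  (M.ground_finite.finite_subsets.subset fun _ hF ↦ IsFlat.subset_ground hF).to_subtype

noncomputable instance fintype_flatLattice (M : Matroid α) [M.Finite] : Fintype M.FlatLattice :=
  Fintype.ofFinite _

open Classical in
noncomputable instance locallyFiniteOrder_flatLattice (M : Matroid α) [M.Finite] :
    LocallyFiniteOrder M.FlatLattice :=
  Fintype.toLocallyFiniteOrder

/-- The least flat, i.e. the closure of the empty set. -/
def leastFlat (M : Matroid α) : M.FlatLattice := ⟨M.closure ∅, M.isFlat_closure ∅⟩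

open Classical in
/-- The one-variable Möbius function `μ(F) = μ(0, F)` of the lattice of flats. -/
noncomputable def flatMobius (M : Matroid α) [M.Finite] (F : M.FlatLattice) : ℤ :=
  IncidenceAlgebra.mu ℤ M.leastFlat F

/-- The characteristic polynomial `χ(M, t) = ∑ μ(F) t ^ (r(M) - r(F))`, summed over the flats. -/
noncomputable def charPoly (M : Matroid α) [M.Finite] : Polynomial ℤ :=
  ∑ F : M.FlatLattice,
    Polynomial.C (M.flatMobius F) * Polynomial.X ^ (M.eRank - M.eRk F.1).toNat

/-- `M` has a divisional flag: a saturated chain of flats `∅ = X 0 ⊆ ⋯ ⊆ X n = E` such that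
`χ(M / X (i + 1), t)` divides `χ(M / X i, t)` for all `i < n`. -/
def HasDivisionalFlag (M : Matroid α) [M.Finite] : Prop :=
  ∃ (n : ℕ) (X : Fin (n + 1) → Set α), M.IsFullFlag n X ∧
    ∀ i : Fin n, (M ／ X i.succ).charPoly ∣ (M ／ X i.castSucc).charPoly

end Matroid

/-- A (central) hyperplane arrangement: a finite set of subspaces of codimension one. -/
structure HyperplaneArrangement (K V : Type*) [Field K] [AddCommGroup V] [Module K V] where
  hyperplanes : Set (Submodule K V)
  finite : hyperplanes.Finite
  codim_eq_one : ∀ H ∈ hyperplanes, Module.finrank K (V ⧸ H) = 1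

namespace HyperplaneArrangement

variable {K V : Type*} [Field K] [AddCommGroup V] [Module K V]

theorem codim_inf_le [FiniteDimensional K V] (W H : Submodule K V)
    (hH : Module.finrank K (V ⧸ H) = 1) :
    Module.finrank K (V ⧸ (H ⊓ W)) ≤ Module.finrank K (V ⧸ W) + 1 := by
  have h1 := Submodule.finrank_quotient_add_finrank H
  have h2 := Submodule.finrank_quotient_add_finrank W
  have h3 := Submodule.finrank_quotient_add_finrank (H ⊓ W)
  have h4 := Submodule.finrank_sup_add_finrank_inf_eq H W
  have h5 := Submodule.finrank_le (H ⊔ W)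
  omega

/-- If adding `H` does not raise the codimension of the intersection `W`, then `W ≤ H`. -/
theorem le_of_codim_inf_eq [FiniteDimensional K V] (W H : Submodule K V)
    (h : Module.finrank K (V ⧸ (H ⊓ W)) ≤ Module.finrank K (V ⧸ W)) : W ≤ H := by
  have h2 := Submodule.finrank_quotient_add_finrank W
  have h3 := Submodule.finrank_quotient_add_finrank (H ⊓ W)
  have h4 : H ⊓ W = W := Submodule.eq_of_le_of_finrank_le inf_le_right (by omega)
  exact inf_eq_right.mp h4

theorem codim_anti [FiniteDimensional K V] {U W : Submodule K V} (h : U ≤ W) :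
    Module.finrank K (V ⧸ W) ≤ Module.finrank K (V ⧸ U) := by
  have h2 := Submodule.finrank_quotient_add_finrank W
  have h3 := Submodule.finrank_quotient_add_finrank U
  have h4 := Submodule.finrank_mono h
  omega

theorem codim_union_le [FiniteDimensional K V] (I : Set (Submodule K V))
    {J : Set (Submodule K V)} (hJ : J.Finite) (h1 : ∀ H ∈ J, Module.finrank K (V ⧸ H) = 1) :
    Module.finrank K (V ⧸ sInf (J ∪ I)) ≤ Module.finrank K (V ⧸ sInf I) + J.ncard := by
  induction J, hJ using Set.Finite.induction_on with
  | empty => rw [Set.empty_union, Set.ncard_empty, add_zero]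
  | @insert H J hHJ hJ ih =>
    rw [Set.insert_union, sInf_insert, Set.ncard_insert_of_notMem hHJ hJ]
    have := codim_inf_le (sInf (J ∪ I)) H (h1 H (Set.mem_insert _ _))
    have := ih fun H' h' ↦ h1 H' (Set.mem_insert_of_mem _ h')
    omega

/-- Independence of a set of hyperplanes: the codimension of their intersection is their number. -/
def Indep (A : HyperplaneArrangement K V) (B : Set (Submodule K V)) : Prop :=
  B ⊆ A.hyperplanes ∧ Module.finrank K (V ⧸ sInf B) = B.ncard

/-- The linear dependence matroid `M(A)` on the set of hyperplanes of `A`. -/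
def matroid [FiniteDimensional K V] (A : HyperplaneArrangement K V) : Matroid (Submodule K V) :=
  (IndepMatroid.ofFinite A.finite A.Indep
    (by
      refine ⟨Set.empty_subset _, ?_⟩
      have := Submodule.finrank_quotient_add_finrank (⊤ : Submodule K V)
      rw [finrank_top] at this
      rw [sInf_empty, Set.ncard_empty]
      omega)
    (by
      rintro I J ⟨hJA, hJ⟩ hIJ
      have hJf := A.finite.subset hJA
      have hIf := hJf.subset hIJ
      refine ⟨hIJ.trans hJA, ?_⟩
      have a := codim_union_le I (J := J \ I) (hJf.subset Set.sdiff_subset)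
        fun H hH ↦ A.codim_eq_one H (hJA hH.1)
      have b := codim_union_le ∅ hIf fun H hH ↦ A.codim_eq_one H (hJA (hIJ hH))
      have c := Submodule.finrank_quotient_add_finrank (⊤ : Submodule K V)
      have d := Set.ncard_sdiff_add_ncard_of_subset hIJ hJf
      rw [finrank_top] at c
      rw [Set.sdiff_union_of_subset hIJ] at a
      rw [Set.union_empty, sInf_empty] at b
      omega)
    (by
      rintro I J ⟨hIA, hI⟩ ⟨hJA, hJ⟩ hlt
      by_contra! hcon
      have key : sInf I ≤ sInf J := by
        refine le_sInf fun H hH ↦ ?_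
        by_cases hHI : H ∈ I
        · exact sInf_le hHI
        · have h1 : ¬ Module.finrank K (V ⧸ sInf (insert H I)) = (insert H I).ncard :=
            fun h ↦ hcon H hH hHI ⟨Set.insert_subset (hJA hH) hIA, h⟩
          rw [sInf_insert, Set.ncard_insert_of_notMem hHI (A.finite.subset hIA)] at h1
          have h2 := codim_inf_le (sInf I) H (A.codim_eq_one H (hJA hH))
          exact le_of_codim_inf_eq _ _ (by omega)
      have := codim_anti key
      omega)
    (fun _ h ↦ h.1)).matroid

instance finite_matroid [FiniteDimensional K V] (A : HyperplaneArrangement K V) :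
    A.matroid.Finite := ⟨A.finite⟩

/-- An arrangement is divisionally free if its linear dependence matroid has a divisional flag. -/
def IsDivisionallyFree [FiniteDimensional K V] (A : HyperplaneArrangement K V) : Prop :=
  A.matroid.HasDivisionalFlag

/-- The arrangement of all hyperplanes of the vector space `K ^ k` over a finite field. -/
def allHyperplanes (K : Type*) [Field K] [Finite K] (k : ℕ) :
    HyperplaneArrangement K (Fin k → K) where
  hyperplanes := {H | Module.finrank K ((Fin k → K) ⧸ H) = 1}
  finite :=
    haveI : Finite (Submodule K (Fin k → K)) := Finite.of_injective _ SetLike.coe_injective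
    Set.toFinite _
  codim_eq_one := fun _ h ↦ h

end HyperplaneArrangement

/-- The projective geometry `PG(k - 1, q)` of rank `k`, where `q` is the order of `K`: the linear
dependence matroid of the arrangement of all hyperplanes of `K ^ k`. It is empty for `k = 0`. -/
def projectiveGeometry (K : Type*) [Field K] [Finite K] (k : ℕ) :
    Matroid (Submodule K (Fin k → K)) :=
  (HyperplaneArrangement.allHyperplanes K k).matroid

/-- The smallest class of finite simple matroids representable over the finite field `K` that
contains the supersolvable ones and is closed under modular joins over projective geometries
over `K`. The factors of a modular join are restrictions of it, so the class is generated
separately on each type of potential elements. -/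
inductive MemJoinClass (K : Type*) [Field K] [Finite K] {α : Type*} : Matroid α → Prop
  | supersolvable (M : Matroid α) (hfin : M.Finite) (hrep : M.IsRepresentableOver K)
      (hss : M.IsSupersolvable) : MemJoinClass K M
  | modularJoin (M : Matroid α) (hfin : M.Finite) (hrep : M.IsRepresentableOver K)
      (E₁ E₂ : Set α) (hjoin : M.IsModularJoin E₁ E₂)
      (k : ℕ) (hPG : (M.restrict (E₁ ∩ E₂)).IsIsomorphicTo (projectiveGeometry K k))
      (h₁ : MemJoinClass K (M.restrict E₁)) (h₂ : MemJoinClass K (M.restrict E₂)) : MemJoinClass K M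

/-!
In a represented matroid, call a flat full if its elements represent all points of the subspace that
it spans; flats that are isomorphic to a projective geometry are full, and full flats are modular.
By induction over the class, every full flat `X` has a complement that is reached from `∅` by a
divisional chain; a divisional flag is the case `X = ∅`.

In a modular join of `E₁` and `E₂`, a full flat `X` lies in one of the two, say in `E₂`, as a vector
space is not the union of two proper subspaces. A divisional chain in `E₁` from `∅` to a complement
`y` of `E₁ ∩ E₂` is still divisional in the join: the characteristic polynomial of an interval
`[a, E]` factors through the modular flat `E₁`, and the cofactor is the same for all `a ≤ y`. From
`y` on, lift a divisional chain in `E₂` from `∅` to a complement of `X` along `z ↦ z ∨ y`.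

In a supersolvable matroid with modular coatom `T`, a full flat `X` with `X ∪ T = E` gives a modular
join of `T` and `X`. Otherwise choose a point `e` outside `X ∪ T`. The projection `(X ∨ e) ∩ T` of
`X` from `e` is again full, and the divisional chain of `T` for this flat, lifted along `z ↦ z ∨ e`,
leads from `e` to a complement of `X`. The first step, from `∅` to `e`, is divisional because `e` is
a complement of the modular coatom `T`.
-/

section MobiusFunction

open Finset IncidenceAlgebra Polynomial

variable {L L' : Type*} [PartialOrder L] [PartialOrder L']

/-- The map `g` restricts to an order isomorphism from `[a, b]` onto `[g a, g b]`. -/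
structure IsIccIso (g : L → L') (a b : L) : Prop where
  le_iff_le : ∀ u ∈ Set.Icc a b, ∀ v ∈ Set.Icc a b, (g u ≤ g v ↔ u ≤ v)
  surjOn : Set.SurjOn g (Set.Icc a b) (Set.Icc (g a) (g b))

theorem IsIccIso.bijOn {g : L → L'} {a b c : L} (hg : IsIccIso g a b) (hc : c ∈ Set.Icc a b) :
    Set.BijOn g (Set.Icc a c) (Set.Icc (g a) (g c)) := by
  have ha : a ∈ Set.Icc a b := ⟨le_rfl, hc.1.trans hc.2⟩
  have hb : b ∈ Set.Icc a b := ⟨hc.1.trans hc.2, le_rfl⟩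
  have hsub : Set.Icc a c ⊆ Set.Icc a b := Set.Icc_subset_Icc_right hc.2
  refine ⟨fun u hu ↦ ?_, fun u hu v hv huv ↦ ?_, fun z hz ↦ ?_⟩
  · exact ⟨(hg.le_iff_le a ha u (hsub hu)).2 hu.1, (hg.le_iff_le u (hsub hu) c hc).2 hu.2⟩
  · exact le_antisymm ((hg.le_iff_le u (hsub hu) v (hsub hv)).1 huv.le)
      ((hg.le_iff_le v (hsub hv) u (hsub hu)).1 huv.ge)
  · obtain ⟨u, hu, rfl⟩ := hg.surjOn ⟨hz.1, hz.2.trans ((hg.le_iff_le c hc b hb).2 hc.2)⟩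
    exact ⟨u, ⟨hu.1, (hg.le_iff_le u hu c hc).1 hz.2⟩, rfl⟩

variable [LocallyFiniteOrder L] [LocallyFiniteOrder L']

theorem eq_mu_of_sum_Icc {𝕜 : Type*} [AddCommGroup 𝕜] [One 𝕜] [DecidableEq L] {f : L → 𝕜}
    {a b : L} (hab : a ≤ b) (hf : ∀ c ∈ Icc a b, ∑ x ∈ Icc a c, f x = if a = c then 1 else 0) :
    f b = mu 𝕜 a b := by
  induction hn : #(Icc a b) using Nat.strong_induction_on generalizing b with
  | _ n ih =>
    have hIco : ∑ x ∈ Ico a b, f x = ∑ x ∈ Ico a b, mu 𝕜 a x := by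
      refine sum_congr rfl fun x hx ↦ ?_
      obtain ⟨hax, hxb⟩ := mem_Ico.1 hx
      exact ih _ (hn ▸ card_lt_card (Icc_ssubset_Icc_right hab le_rfl hxb)) hax
        (fun c hc ↦ hf c (Icc_subset_Icc_right hxb.le hc)) rfl
    have hIcc := hf b (right_mem_Icc.2 hab)
    rwa [← sum_Icc_mu_right, Icc_eq_cons_Ico hab, sum_cons, sum_cons, hIco,
      add_left_inj] at hIcc

theorem IsIccIso.mu_eq {𝕜 : Type*} [AddCommGroup 𝕜] [One 𝕜] [DecidableEq L] [DecidableEq L']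
    {g : L → L'} {a b c : L} (hg : IsIccIso g a b) (hc : c ∈ Set.Icc a b) :
    mu 𝕜 a c = mu 𝕜 (g a) (g c) := by
  refine (eq_mu_of_sum_Icc (f := fun z ↦ mu 𝕜 (g a) (g z)) hc.1 fun d hd ↦ ?_).symm
  obtain ⟨had, hdc⟩ := mem_Icc.1 hd
  have hbij := hg.bijOn ⟨had, hdc.trans hc.2⟩
  have heq : g a = g d ↔ a = d :=
    hbij.injOn.eq_iff (Set.left_mem_Icc.2 had) (Set.right_mem_Icc.2 had)
  simp only [← heq, ← sum_Icc_mu_right]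
  rw [← coe_Icc, ← coe_Icc] at hbij
  exact sum_nbij g hbij.mapsTo hbij.injOn hbij.surjOn fun _ _ ↦ rfl

open scoped Classical in
/-- The characteristic polynomial of the interval `[a, b]` with respect to the rank
function `ρ`. -/
noncomputable def intervalCharPoly (ρ : L → ℕ) (a b : L) : ℤ[X] :=
  ∑ z ∈ Icc a b, C (mu ℤ a z) * X ^ (ρ b - ρ z)

theorem IsIccIso.intervalCharPoly_eq {ρ : L → ℕ} {ρ' : L' → ℕ} {g : L → L'} {a b : L}
    (hg : IsIccIso g a b) (hab : a ≤ b)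
    (hρ : ∀ c ∈ Set.Icc a b, ρ b - ρ c = ρ' (g b) - ρ' (g c)) :
    intervalCharPoly ρ a b = intervalCharPoly ρ' (g a) (g b) := by
  classical
  have hbij := hg.bijOn (Set.right_mem_Icc.2 hab)
  rw [← coe_Icc, ← coe_Icc] at hbij
  refine sum_nbij g hbij.mapsTo hbij.injOn hbij.surjOn fun c hc ↦ ?_
  rw [hρ c (mem_Icc.1 hc), hg.mu_eq (mem_Icc.1 hc)]

end MobiusFunction

section ModularElements

/-- `x` is a modular element of the interval `[⊥, w]`. -/
structure IsModularBelow {L : Type*} [Lattice L] (ρ : L → ℕ) (w x : L) : Prop where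
  le : x ≤ w
  modular : ∀ y ≤ w, ρ (y ⊓ x) + ρ (y ⊔ x) = ρ y + ρ x

/-- The interval `[⊥, w]` is a modular join of `[⊥, x]` and `[⊥, x']`: both are modular, and every
element of `[⊥, w]` is the join of its parts below `x` and below `x'`. -/
structure IsModularJoinBelow {L : Type*} [Lattice L] (ρ : L → ℕ) (w x x' : L) : Prop where
  left : IsModularBelow ρ w x
  right : IsModularBelow ρ w x'
  le_sup : ∀ z ≤ w, z ≤ z ⊓ x ⊔ z ⊓ x'

/-- A rank function of a semimodular lattice. -/
structure IsSemimodularRank {L : Type*} [Lattice L] [OrderBot L] (ρ : L → ℕ) : Prop where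
  strictMono : StrictMono ρ
  bot : ρ ⊥ = 0
  submodular : ∀ x y, ρ (x ⊓ y) + ρ (x ⊔ y) ≤ ρ x + ρ y

variable {L : Type*} [Lattice L] {ρ : L → ℕ} {w w' x x' y z u a b e : L}

theorem IsModularBelow.mono (hx : IsModularBelow ρ w x) (hxw : x ≤ w') (hw : w' ≤ w) :
    IsModularBelow ρ w' x :=
  ⟨hxw, fun y hy ↦ hx.modular y (hy.trans hw)⟩

theorem IsModularJoinBelow.symm (h : IsModularJoinBelow ρ w x x') :
    IsModularJoinBelow ρ w x' x :=
  ⟨h.right, h.left, fun z hz ↦ (h.le_sup z hz).trans_eq (sup_comm _ _)⟩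

theorem IsModularJoinBelow.sup_eq (h : IsModularJoinBelow ρ w x x') : x ⊔ x' = w :=
  le_antisymm (sup_le h.left.le h.right.le)
    ((h.le_sup w le_rfl).trans (sup_le_sup inf_le_right inf_le_right))

variable [OrderBot L]

theorem IsSemimodularRank.eq_of_le_of_rank_le (hρ : IsSemimodularRank ρ) (hxy : x ≤ y)
    (hr : ρ y ≤ ρ x) : x = y :=
  hxy.eq_of_not_lt fun hlt ↦ (hρ.strictMono hlt).not_ge hr

theorem IsSemimodularRank.isAtom_of_rank_eq_one (hρ : IsSemimodularRank ρ) (he : ρ e = 1) :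
    IsAtom e := by
  refine ⟨fun h ↦ by simp [h, hρ.bot] at he, fun z hz ↦ ?_⟩
  have hlt := hρ.strictMono hz
  exact (hρ.eq_of_le_of_rank_le bot_le (by omega)).symm

theorem IsSemimodularRank.rank_sup_of_rank_eq_one (hρ : IsSemimodularRank ρ) (he : ρ e = 1)
    (hex : ¬ e ≤ x) : ρ (x ⊔ e) = ρ x + 1 := by
  have hlt := hρ.strictMono (left_lt_sup.2 hex)
  have hsub := hρ.submodular x e
  omega

namespace IsModularBelow

theorem sup_inf_assoc_of_le (hρ : IsSemimodularRank ρ) (hx : IsModularBelow ρ w x) (hy : y ≤ w)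
    (hu : u ≤ x) : (u ⊔ y) ⊓ x = u ⊔ y ⊓ x := by
  have hle : u ⊔ y ⊓ x ≤ (u ⊔ y) ⊓ x :=
    sup_le (le_inf le_sup_left hu) (inf_le_inf_right x le_sup_right)
  refine (hρ.eq_of_le_of_rank_le hle ?_).symm
  have hmod := hx.modular y hy
  have hmod' := hx.modular (u ⊔ y) (sup_le (hu.trans hx.le) hy)
  have hsub := hρ.submodular (u ⊔ y ⊓ x) y
  have hinf : ρ (y ⊓ x) ≤ ρ ((u ⊔ y ⊓ x) ⊓ y) :=
    hρ.strictMono.monotone (le_inf le_sup_right inf_le_left)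
  have hsup : u ⊔ y ⊓ x ⊔ y = u ⊔ y := by
    rw [sup_assoc, sup_eq_right.2 (inf_le_left : y ⊓ x ≤ y)]
  have hsup' : u ⊔ y ⊔ x = y ⊔ x := by rw [sup_right_comm, sup_eq_right.2 hu, sup_comm]
  rw [hsup] at hsub
  rw [hsup'] at hmod'
  omega

theorem inf_sup_assoc_of_le (hρ : IsSemimodularRank ρ) (hx : IsModularBelow ρ w x) (hz : z ≤ w)
    (hyz : y ≤ z) : z ⊓ x ⊔ y = z ⊓ (x ⊔ y) := by
  have hle : z ⊓ x ⊔ y ≤ z ⊓ (x ⊔ y) :=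
    sup_le (inf_le_inf_left z le_sup_left) (le_inf hyz le_sup_right)
  refine hρ.eq_of_le_of_rank_le hle ?_
  have hmod := hx.modular (z ⊓ (x ⊔ y)) (inf_le_left.trans hz)
  have hmod' := hx.modular (z ⊓ x ⊔ y) (sup_le (inf_le_left.trans hz) (hyz.trans hz))
  have hinf : z ⊓ (x ⊔ y) ⊓ x = z ⊓ x := by
    rw [inf_assoc, inf_eq_right.2 (le_sup_left : x ≤ x ⊔ y)]
  have hinf' : ρ (z ⊓ x) ≤ ρ ((z ⊓ x ⊔ y) ⊓ x) :=
    hρ.strictMono.monotone (le_inf le_sup_left inf_le_right)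
  have hsup : ρ (z ⊓ (x ⊔ y) ⊔ x) ≤ ρ (z ⊓ x ⊔ y ⊔ x) :=
    hρ.strictMono.monotone (sup_le (inf_le_right.trans
      (sup_le le_sup_right (le_sup_of_le_left le_sup_right))) le_sup_right)
  rw [hinf] at hmod
  omega

theorem rank_sup_add (hρ : IsSemimodularRank ρ) (hx : IsModularBelow ρ w x) (hy : y ≤ w)
    (hyu : y ⊓ x ≤ u) (hux : u ≤ x) : ρ (u ⊔ y) + ρ (y ⊓ x) = ρ u + ρ y := by
  have hmod := hx.modular y hy
  have hmod' := hx.modular (u ⊔ y) (sup_le (hux.trans hx.le) hy)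
  have hsup : u ⊔ y ⊔ x = y ⊔ x := by rw [sup_right_comm, sup_eq_right.2 hux, sup_comm]
  rw [hx.sup_inf_assoc_of_le hρ hy hux, sup_eq_left.2 hyu, hsup] at hmod'
  omega

theorem rank_sup_of_disjoint (hρ : IsSemimodularRank ρ) (hx : IsModularBelow ρ w x) (hy : y ≤ w)
    (hyx : Disjoint y x) (hux : u ≤ x) : ρ (u ⊔ y) = ρ u + ρ y := by
  simpa [hyx.eq_bot, hρ.bot] using hx.rank_sup_add hρ hy (hyx.eq_bot ▸ bot_le) hux

theorem not_disjoint_of_one_lt_rank (hρ : IsSemimodularRank ρ) (hx : IsModularBelow ρ w x)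
    (hrx : ρ w = ρ x + 1) (hy : y ≤ w) (hry : 1 < ρ y) : ¬ Disjoint y x := fun hyx ↦ by
  have hrank := hx.rank_sup_of_disjoint hρ hy hyx le_rfl
  have hle := hρ.strictMono.monotone (sup_le hx.le hy)
  omega

theorem isIccIso_sup (hρ : IsSemimodularRank ρ) (hx : IsModularBelow ρ w x) (hy : y ≤ w)
    (ha : y ⊓ x ≤ a) (hab : a ≤ b) (hbx : b ≤ x) : IsIccIso (· ⊔ y) a b := by
  have hleft : ∀ u ∈ Set.Icc a b, (u ⊔ y) ⊓ x = u := fun u hu ↦ by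
    rw [hx.sup_inf_assoc_of_le hρ hy (hu.2.trans hbx), sup_eq_left.2 (ha.trans hu.1)]
  refine ⟨fun u hu v hv ↦ ⟨fun huv ↦ ?_, fun huv ↦ sup_le_sup_right huv y⟩, fun z hz ↦ ?_⟩
  · rw [← hleft u hu, ← hleft v hv]
    exact inf_le_inf_right x huv
  · have hzb : z ⊓ x ≤ b := hleft b ⟨hab, le_rfl⟩ ▸ inf_le_inf_right x hz.2
    refine ⟨z ⊓ x, ⟨le_inf (le_sup_left.trans hz.1) (hab.trans hbx), hzb⟩, ?_⟩
    have hzw : z ≤ w := hz.2.trans (sup_le (hbx.trans hx.le) hy)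
    change z ⊓ x ⊔ y = z
    rw [hx.inf_sup_assoc_of_le hρ hzw (le_sup_right.trans hz.1), inf_eq_left]
    exact hz.2.trans (sup_le_sup_right hbx y)

theorem intervalCharPoly_sup [LocallyFiniteOrder L] (hρ : IsSemimodularRank ρ)
    (hx : IsModularBelow ρ w x) (hy : y ≤ w) (ha : y ⊓ x ≤ a) (hab : a ≤ b) (hbx : b ≤ x) :
    intervalCharPoly ρ (a ⊔ y) (b ⊔ y) = intervalCharPoly ρ a b := by
  refine ((hx.isIccIso_sup hρ hy ha hab hbx).intervalCharPoly_eq hab fun c hc ↦ ?_).symm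
  have hrankb := hx.rank_sup_add hρ hy (ha.trans hab) hbx
  have hrankc := hx.rank_sup_add hρ hy (ha.trans hc.1) (hc.2.trans hbx)
  omega

end IsModularBelow

end ModularElements

section Factorization

open IncidenceAlgebra Polynomial Finset

variable {L : Type*} [Lattice L] [LocallyFiniteOrder L] {ρ : L → ℕ} {a w x x' y z : L}

theorem sum_Icc_sum_sup_eq {R : Type*} [Ring R] [DecidableEq L] (hzw : z ≤ w) (f : L → R) :
    ∑ c ∈ Icc a z, ∑ p ∈ Icc a x ×ˢ {y ∈ Icc a w | y ⊓ x = a} with p.1 ⊔ p.2 = c,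
      (f p.1 * f p.2) = (∑ u ∈ Icc a (x ⊓ z), f u) * ∑ y ∈ Icc a z with y ⊓ x = a, f y := by
  rw [sum_mul_sum, ← sum_product',
    ← sum_fiberwise_of_maps_to (t := Icc a z) (g := fun p : L × L ↦ p.1 ⊔ p.2)]
  · refine sum_congr rfl fun c hc ↦ sum_congr ?_ fun _ _ ↦ rfl
    ext ⟨u, y⟩
    have hcz := (mem_Icc.1 hc).2
    simp only [mem_filter, mem_product, mem_Icc, le_inf_iff]
    constructor
    · rintro ⟨⟨⟨hau, hux⟩, ⟨hay, -⟩, hyx⟩, rfl⟩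
      exact ⟨⟨⟨hau, hux, le_sup_left.trans hcz⟩, ⟨hay, le_sup_right.trans hcz⟩, hyx⟩, rfl⟩
    · rintro ⟨⟨⟨hau, hux, -⟩, ⟨hay, hyz⟩, hyx⟩, rfl⟩
      exact ⟨⟨⟨hau, hux⟩, ⟨hay, hyz.trans hzw⟩, hyx⟩, rfl⟩
  · rintro ⟨u, y⟩ hp
    simp only [mem_filter, mem_product, mem_Icc, le_inf_iff] at hp ⊢
    exact ⟨hp.1.1.trans le_sup_left, sup_le hp.1.2.2 hp.2.1.2⟩

theorem mu_eq_sum_mul {𝕜 : Type*} [Ring 𝕜] [DecidableEq L] (hax : a ≤ x) (haz : a ≤ z)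
    (hzw : z ≤ w) :
    mu 𝕜 a z = ∑ p ∈ Icc a x ×ˢ {y ∈ Icc a w | y ⊓ x = a} with p.1 ⊔ p.2 = z,
      mu 𝕜 a p.1 * mu 𝕜 a p.2 := by
  refine (eq_mu_of_sum_Icc (f := fun z ↦ ∑ p ∈ Icc a x ×ˢ {y ∈ Icc a w | y ⊓ x = a} with
    p.1 ⊔ p.2 = z, mu 𝕜 a p.1 * mu 𝕜 a p.2) haz fun c hc ↦ ?_).symm
  obtain ⟨hac, hcz⟩ := mem_Icc.1 hc
  rw [sum_Icc_sum_sup_eq (hcz.trans hzw) (mu 𝕜 a), sum_Icc_mu_right]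
  by_cases hxc : a = x ⊓ c
  · have hfilter : {y ∈ Icc a c | y ⊓ x = a} = Icc a c := filter_true_of_mem fun y hy ↦ by
      obtain ⟨hay, hyc⟩ := mem_Icc.1 hy
      exact le_antisymm (hxc ▸ le_inf inf_le_right (inf_le_left.trans hyc)) (le_inf hay hax)
    rw [if_pos hxc, one_mul, hfilter, sum_Icc_mu_right]
  · have hne : a ≠ c := by
      rintro rfl
      exact hxc (inf_eq_right.2 hax).symm
    rw [if_neg hxc, zero_mul, if_neg hne]

open scoped Classical in
/-- The quotient of the characteristic polynomial of `[a, w]` by that of `[a, x]`, for a modular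
element `x` of `[⊥, w]`. -/
noncomputable def modularCofactor (ρ : L → ℕ) (a x w : L) : ℤ[X] :=
  ∑ y ∈ Icc a w with y ⊓ x = a, C (mu ℤ a y) * X ^ (ρ w - ρ x - (ρ y - ρ a))

open scoped Classical in
theorem intervalCharPoly_eq_sum_product (ρ : L → ℕ) (hax : a ≤ x) (hxw : x ≤ w) :
    intervalCharPoly ρ a w = ∑ p ∈ Icc a x ×ˢ {y ∈ Icc a w | y ⊓ x = a},
      C (mu ℤ a p.1 * mu ℤ a p.2) * X ^ (ρ w - ρ (p.1 ⊔ p.2)) := by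
  rw [← sum_fiberwise_of_maps_to (t := Icc a w) (g := fun p : L × L ↦ p.1 ⊔ p.2),
    intervalCharPoly]
  · refine sum_congr rfl fun z hz ↦ ?_
    obtain ⟨haz, hzw⟩ := mem_Icc.1 hz
    rw [mu_eq_sum_mul hax haz hzw, map_sum, sum_mul]
    exact sum_congr rfl fun p hp ↦ by rw [(mem_filter.1 hp).2]
  · rintro ⟨u, y⟩ hp
    simp only [mem_filter, mem_product, mem_Icc] at hp ⊢
    exact ⟨hp.1.1.trans le_sup_left, sup_le (hp.1.2.trans hxw) hp.2.1.2⟩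

variable [OrderBot L]

theorem IsModularBelow.intervalCharPoly_eq_mul (hρ : IsSemimodularRank ρ)
    (hx : IsModularBelow ρ w x) (hax : a ≤ x) :
    intervalCharPoly ρ a w = intervalCharPoly ρ a x * modularCofactor ρ a x w := by
  classical
  rw [intervalCharPoly_eq_sum_product ρ hax hx.le, intervalCharPoly, modularCofactor,
    sum_mul_sum, sum_product]
  refine sum_congr rfl fun u hu ↦ sum_congr rfl fun y hy ↦ ?_
  obtain ⟨hau, hux⟩ := mem_Icc.1 hu
  obtain ⟨hy, hyx⟩ := mem_filter.1 hy
  obtain ⟨hay, hyw⟩ := mem_Icc.1 hy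
  have hdeg : ρ w - ρ (u ⊔ y) = (ρ x - ρ u) + (ρ w - ρ x - (ρ y - ρ a)) := by
    have hrank := hx.rank_sup_add hρ hyw (hyx.trans_le hau) hux
    have hrank' := hx.rank_sup_add hρ hyw (hyx.trans_le hax) le_rfl
    have hle := hρ.strictMono.monotone (sup_le hx.le hyw)
    have hle' := hρ.strictMono.monotone hay
    have hle'' := hρ.strictMono.monotone hux
    rw [hyx] at hrank hrank'
    omega
  rw [hdeg, pow_add, map_mul]
  ring

theorem IsModularJoinBelow.modularCofactor_eq_bot (hρ : IsSemimodularRank ρ)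
    (h : IsModularJoinBelow ρ w x x') (hyx : y ≤ x) (hyx' : Disjoint y x') :
    modularCofactor ρ y x w = modularCofactor ρ ⊥ x w := by
  classical
  have hyw : y ≤ w := hyx.trans h.left.le
  have hle : ∀ z ≤ w, z ⊓ x = ⊥ → z ≤ x' := fun z hz hzx ↦ by
    simpa [hzx] using h.le_sup z hz
  have hinv : ∀ z ≤ x', (z ⊔ y) ⊓ x' = z := fun z hz ↦ by
    rw [h.right.sup_inf_assoc_of_le hρ hyw hz, hyx'.eq_bot, sup_bot_eq]
  symm
  refine sum_nbij' (· ⊔ y) (· ⊓ x') ?_ ?_ ?_ ?_ ?_ <;>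
    simp only [mem_filter, mem_Icc, bot_le, true_and]
  · rintro z ⟨hzw, hzx⟩
    refine ⟨⟨le_sup_right, sup_le hzw hyw⟩, ?_⟩
    rw [sup_comm, h.left.sup_inf_assoc_of_le hρ hzw hyx, hzx, sup_bot_eq]
  · rintro z ⟨⟨-, hzw⟩, hzx⟩
    exact ⟨inf_le_left.trans hzw, by rw [inf_right_comm, hzx, hyx'.eq_bot]⟩
  · rintro z ⟨hzw, hzx⟩
    exact hinv z (hle z hzw hzx)
  · rintro z ⟨⟨hyz, hzw⟩, hzx⟩
    refine le_antisymm (sup_le inf_le_left hyz) ?_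
    simpa only [hzx, sup_comm] using h.le_sup z hzw
  · rintro z ⟨hzw, hzx⟩
    have hzx' := hle z hzw hzx
    have hmu := (h.right.isIccIso_sup hρ hyw hyx'.eq_bot.le bot_le le_rfl).mu_eq (𝕜 := ℤ)
      ⟨bot_le, hzx'⟩
    rw [bot_sup_eq] at hmu
    rw [hmu, h.right.rank_sup_of_disjoint hρ hyw hyx' hzx', hρ.bot, Nat.add_sub_cancel,
      Nat.sub_zero]

end Factorization

section DivisionalChains

open Relation

/-- A step of a divisional chain of the interval `[⊥, w]`. -/
structure DivisionalStep {L : Type*} [PartialOrder L] [LocallyFiniteOrder L] (ρ : L → ℕ)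
    (w a b : L) : Prop where
  le : a ≤ b
  le_top : b ≤ w
  rank : ρ b = ρ a + 1
  dvd : intervalCharPoly ρ b w ∣ intervalCharPoly ρ a w

variable {L : Type*} [Lattice L] [OrderBot L] [LocallyFiniteOrder L] {ρ : L → ℕ}
  {w x x' y z a b e t p : L}

/-- Some divisional chain of `[⊥, w]` leads from `⊥` to a complement of `x` whose rank is the
corank of `x`. For `x = ⊥` this is a divisional chain from `⊥` to `w`. -/
def HasDivisionalComplement (ρ : L → ℕ) (w x : L) : Prop :=
  ∃ z ≤ w, ReflTransGen (DivisionalStep ρ w) ⊥ z ∧ Disjoint z x ∧ ρ z + ρ x = ρ w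

theorem DivisionalStep.sup (hρ : IsSemimodularRank ρ) (hx : IsModularBelow ρ w x)
    (hxy : x ⊔ y = w) (hya : y ⊓ x ≤ a) (h : DivisionalStep ρ x a b) :
    DivisionalStep ρ w (a ⊔ y) (b ⊔ y) := by
  have hyw : y ≤ w := hxy ▸ le_sup_right
  refine ⟨sup_le_sup_right h.le y, sup_le (h.le_top.trans hx.le) hyw, ?_, ?_⟩
  · have hranka := hx.rank_sup_add hρ hyw hya (h.le.trans h.le_top)
    have hrankb := hx.rank_sup_add hρ hyw (hya.trans h.le) h.le_top
    have hrank := h.rank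
    omega
  · have hdvd := h.dvd
    rwa [← hx.intervalCharPoly_sup hρ hyw hya (h.le.trans h.le_top) le_rfl,
      ← hx.intervalCharPoly_sup hρ hyw (hya.trans h.le) h.le_top le_rfl, hxy] at hdvd

theorem reflTransGen_divisionalStep_sup (hρ : IsSemimodularRank ρ) (hx : IsModularBelow ρ w x)
    (hxy : x ⊔ y = w) (hyx : Disjoint y x) (hz : ReflTransGen (DivisionalStep ρ x) ⊥ z) :
    ReflTransGen (DivisionalStep ρ w) y (z ⊔ y) := by
  have hlift : ReflTransGen (DivisionalStep ρ w) (⊥ ⊔ y) (z ⊔ y) :=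
    hz.lift (· ⊔ y) fun a b hab ↦ hab.sup hρ hx hxy (hyx.eq_bot ▸ bot_le)
  rwa [bot_sup_eq] at hlift

/-- The cofactors of the two characteristic polynomials are the same, as `a` and `b` both meet `x'`
trivially. -/
theorem DivisionalStep.of_isModularJoinBelow (hρ : IsSemimodularRank ρ)
    (hw : IsModularJoinBelow ρ w x x') (hb : Disjoint b x') (h : DivisionalStep ρ x a b) :
    DivisionalStep ρ w a b := by
  refine ⟨h.le, h.le_top.trans hw.left.le, h.rank, ?_⟩
  rw [hw.left.intervalCharPoly_eq_mul hρ h.le_top,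
    hw.left.intervalCharPoly_eq_mul hρ (h.le.trans h.le_top),
    hw.modularCofactor_eq_bot hρ h.le_top hb,
    hw.modularCofactor_eq_bot hρ (h.le.trans h.le_top) (hb.mono_left h.le)]
  exact mul_dvd_mul_right h.dvd _

theorem reflTransGen_divisionalStep_of_isModularJoinBelow (hρ : IsSemimodularRank ρ)
    (hw : IsModularJoinBelow ρ w x x') (hz : ReflTransGen (DivisionalStep ρ x) ⊥ z)
    (hzx' : Disjoint z x') : ReflTransGen (DivisionalStep ρ w) ⊥ z := by
  induction hz with
  | refl => exact .refl
  | tail _ hbc ih => exact (ih (hzx'.mono_left hbc.le)).tail (hbc.of_isModularJoinBelow hρ hw hzx')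

namespace HasDivisionalComplement

theorem self (hρ : IsSemimodularRank ρ) (w : L) : HasDivisionalComplement ρ w w :=
  ⟨⊥, bot_le, .refl, disjoint_bot_left, by rw [hρ.bot, zero_add]⟩

theorem of_isModularJoinBelow (hρ : IsSemimodularRank ρ) (hw : IsModularJoinBelow ρ w x x')
    (hp : p ≤ x') (hxx' : HasDivisionalComplement ρ x (x ⊓ x'))
    (hx'p : HasDivisionalComplement ρ x' p) : HasDivisionalComplement ρ w p := by
  obtain ⟨y, hyx, hchain, hy, hry⟩ := hxx'
  obtain ⟨z, hzx', hchain', hzp, hrz⟩ := hx'p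
  have hyx' : Disjoint y x' := by
    rwa [disjoint_iff, ← inf_assoc, inf_eq_left.2 hyx, ← disjoint_iff] at hy
  have hyw := hyx.trans hw.left.le
  have hrank : ρ y + ρ x' = ρ w := by
    have hmod := hw.right.modular x hw.left.le
    rw [hw.sup_eq] at hmod
    omega
  have hx'y : x' ⊔ y = w := hρ.eq_of_le_of_rank_le (sup_le hw.right.le hyw) <| by
    rw [hw.right.rank_sup_of_disjoint hρ hyw hyx' le_rfl, add_comm, hrank]
  refine ⟨z ⊔ y, sup_le (hzx'.trans hw.right.le) hyw,
    (reflTransGen_divisionalStep_of_isModularJoinBelow hρ hw hchain hyx').trans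
      (reflTransGen_divisionalStep_sup hρ hw.right hx'y hyx' hchain'), ?_, ?_⟩
  · rw [disjoint_iff, ← inf_eq_right.2 hp, ← inf_assoc,
      hw.right.sup_inf_assoc_of_le hρ hyw hzx', hyx'.eq_bot, sup_bot_eq, hzp.eq_bot]
  · rw [hw.right.rank_sup_of_disjoint hρ hyw hyx' hzx']
    omega

theorem of_coatom (hρ : IsSemimodularRank ρ) (ht : IsModularBelow ρ w t) (hrt : ρ w = ρ t + 1)
    (hxw : x ≤ w) (hew : e ≤ w) (he : ρ e = 1) (het : ¬ e ≤ t) (hex : ¬ e ≤ x)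
    (h : HasDivisionalComplement ρ t ((x ⊔ e) ⊓ t)) : HasDivisionalComplement ρ w x := by
  obtain ⟨z, hzt, hchain, hz, hrz⟩ := h
  have hatom := hρ.isAtom_of_rank_eq_one he
  have hdt : Disjoint e t := hatom.not_le_iff_disjoint.1 het
  have hdx : Disjoint e x := hatom.not_le_iff_disjoint.1 hex
  have hte : t ⊔ e = w := hρ.eq_of_le_of_rank_le (sup_le ht.le hew) <| by
    rw [ht.rank_sup_of_disjoint hρ hew hdt le_rfl, hrt, he]
  have hfirst : DivisionalStep ρ w ⊥ e := by
    refine ⟨bot_le, hew, by rw [hρ.bot, he], ?_⟩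
    have hiso := ht.intervalCharPoly_sup hρ hew hdt.eq_bot.le bot_le le_rfl
    rw [bot_sup_eq, hte] at hiso
    rw [hiso, ht.intervalCharPoly_eq_mul hρ bot_le]
    exact dvd_mul_right _ _
  have hmodular : ∀ y ≤ w, e ≤ y → y ⊓ t ⊔ e = y := fun y hy hey ↦ by
    rw [ht.inf_sup_assoc_of_le hρ hy hey, hte, inf_eq_left.2 hy]
  refine ⟨z ⊔ e, sup_le (hzt.trans ht.le) hew,
    (ReflTransGen.single hfirst).trans (reflTransGen_divisionalStep_sup hρ ht hte hdt hchain),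
    ?_, ?_⟩
  · have hmeet_t : (z ⊔ e) ⊓ (x ⊔ e) ⊓ t = ⊥ := by
      rw [inf_inf_distrib_right, ht.sup_inf_assoc_of_le hρ hew hzt, hdt.eq_bot, sup_bot_eq,
        hz.eq_bot]
    have hmeet : (z ⊔ e) ⊓ (x ⊔ e) = e := by
      rw [← hmodular _ (inf_le_right.trans (sup_le hxw hew)) (le_inf le_sup_right le_sup_right),
        hmeet_t, bot_sup_eq]
    rw [disjoint_iff, ← inf_eq_right.2 (le_sup_left : x ≤ x ⊔ e), ← inf_assoc, hmeet,
      hdx.eq_bot]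
  · have hrankz := ht.rank_sup_of_disjoint hρ hew hdt hzt
    have hrankx := ht.rank_sup_of_disjoint hρ hew hdt (inf_le_right : (x ⊔ e) ⊓ t ≤ t)
    rw [hmodular _ (sup_le hxw hew) le_sup_right] at hrankx
    have hrank := hρ.rank_sup_of_rank_eq_one he hex
    omega

end HasDivisionalComplement

end DivisionalChains

section Flats

open Matroid

variable {α : Type*} {M : Matroid α} {F G H : M.FlatLattice} {e g : α}

theorem closure_subset_of_isFlat {F X : Set α} (hF : M.IsFlat F) (hX : X ⊆ F) :
    M.closure X ⊆ F :=
  (M.closure_subset_closure hX).trans hF.closure.subset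

instance : Lattice M.FlatLattice where
  sup F G := ⟨M.closure (F.1 ∪ G.1), M.isFlat_closure _⟩
  inf F G := ⟨F.1 ∩ G.1, by
    rw [Set.inter_eq_iInter]
    exact IsFlat.iInter fun b ↦ by cases b; exacts [G.2, F.2]⟩
  le_sup_left F _ := M.subset_closure_of_subset' Set.subset_union_left F.2.subset_ground
  le_sup_right _ G := M.subset_closure_of_subset' Set.subset_union_right G.2.subset_ground
  sup_le _ _ H hF hG := closure_subset_of_isFlat H.2 (Set.union_subset hF hG)
  inf_le_left _ _ := Set.inter_subset_left
  inf_le_right _ _ := Set.inter_subset_right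
  le_inf _ _ _ hF hG := Set.subset_inter hF hG

instance : BoundedOrder M.FlatLattice where
  bot := M.leastFlat
  bot_le F := closure_subset_of_isFlat F.2 (Set.empty_subset _)
  top := ⟨M.E, M.ground_isFlat⟩
  le_top F := F.2.subset_ground

theorem coe_flat_sup (F G : M.FlatLattice) : (F ⊔ G).1 = M.closure (F.1 ∪ G.1) := rfl

theorem coe_flat_bot : (⊥ : M.FlatLattice).1 = M.closure ∅ := rfl

theorem coe_flat_top : (⊤ : M.FlatLattice).1 = M.E := rfl

/-- The rank of a flat as a natural number. -/
noncomputable def flatRank (M : Matroid α) (F : M.FlatLattice) : ℕ := (M.eRk F.1).toNat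

/-- The flat spanned by a single element; it is the least flat if that element is a loop. -/
def pointFlat (M : Matroid α) (e : α) : M.FlatLattice := ⟨M.closure {e}, M.isFlat_closure _⟩

theorem pointFlat_le_iff (he : e ∈ M.E) : pointFlat M e ≤ F ↔ e ∈ F.1 :=
  ⟨fun h ↦ h (M.mem_closure_of_mem' rfl he),
    fun h ↦ closure_subset_of_isFlat F.2 (Set.singleton_subset_iff.2 h)⟩

theorem le_inf_sup_inf_of_subset_union (hFGH : F.1 ⊆ G.1 ∪ H.1) : F ≤ F ⊓ G ⊔ F ⊓ H :=
  fun _ he ↦ M.mem_closure_of_mem' ((hFGH he).imp (⟨he, ·⟩) (⟨he, ·⟩)) (F.2.subset_ground he)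

theorem flatRank_pointFlat (he : e ∈ M.E) (heF : e ∉ F.1) : flatRank M (pointFlat M e) = 1 := by
  have hnonloop : M.IsNonloop e :=
    ⟨fun hloop ↦ heF ((bot_le : ⊥ ≤ F) hloop), he⟩
  rw [flatRank, pointFlat, eRk_closure_eq, hnonloop.eRk_eq, ENat.toNat_one]

theorem isModularJoinBelow_of_subset_union (hF : IsModularBelow (flatRank M) H F)
    (hG : IsModularBelow (flatRank M) H G) (hH : H.1 ⊆ F.1 ∪ G.1) :
    IsModularJoinBelow (flatRank M) H F G :=
  ⟨hF, hG, fun _ hz ↦ le_inf_sup_inf_of_subset_union ((show _ ⊆ H.1 from hz).trans hH)⟩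

variable [M.Finite]

theorem coe_flatRank (F : M.FlatLattice) : (flatRank M F : ℕ∞) = M.eRk F.1 :=
  ENat.natCast_toNat (eRk_ne_top_iff.2 (M.isRkFinite_set _))

theorem isSemimodularRank_flatRank (M : Matroid α) [M.Finite] :
    IsSemimodularRank (flatRank M) where
  strictMono F G hFG := by
    rw [← ENat.natCast_lt_natCast, coe_flatRank, coe_flatRank]
    refine lt_of_not_ge fun hle ↦ hFG.ne (Subtype.ext ?_)
    rw [← F.2.closure, ← G.2.closure]
    exact (M.isRkFinite_set _).closure_eq_closure_of_subset_of_eRk_ge_eRk hFG.le hle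
  bot := by rw [flatRank, coe_flat_bot, eRk_closure_eq, eRk_empty, ENat.toNat_zero]
  submodular F G := by
    rw [← ENat.natCast_le_natCast]
    push_cast
    simp only [coe_flatRank, coe_flat_sup, eRk_closure_eq]
    exact M.eRk_inter_add_eRk_union_le _ _

theorem exists_mem_sup_pointFlat_inf (hG : IsModularBelow (flatRank M) H G)
    (hHG : flatRank M H = flatRank M G + 1) (he : e ∈ H.1) (hg : g ∈ H.1)
    (hge : g ∉ (pointFlat M e).1) (heG : e ∉ G.1) :
    ∃ y ∈ ((pointFlat M e ⊔ pointFlat M g) ⊓ G).1, y ∉ (⊥ : M.FlatLattice).1 := by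
  have hρ := isSemimodularRank_flatRank M
  have heE := H.2.subset_ground he
  have hgE := H.2.subset_ground hg
  have hline : flatRank M (pointFlat M e ⊔ pointFlat M g) = 2 := by
    rw [hρ.rank_sup_of_rank_eq_one (flatRank_pointFlat hgE hge)
      (mt (pointFlat_le_iff hgE).1 hge), flatRank_pointFlat heE heG]
  have hle : pointFlat M e ⊔ pointFlat M g ≤ H :=
    sup_le ((pointFlat_le_iff heE).2 he) ((pointFlat_le_iff hgE).2 hg)
  have hmeet := hG.not_disjoint_of_one_lt_rank hρ hHG hle (hline ▸ one_lt_two)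
  rw [disjoint_iff_inf_le] at hmeet
  exact Set.not_subset.1 hmeet

end Flats

section LinearRepresentations

open Matroid Submodule

variable {α K V : Type*} [Field K] [AddCommGroup V] [Module K V] {M : Matroid α} {v : α → V}

/-- The family of vectors `v` represents the matroid `M` over `K`. -/
def IsLinearRep (K : Type*) [Field K] {V : Type*} [AddCommGroup V] [Module K V] (M : Matroid α)
    (v : α → V) : Prop :=
  ∀ I ⊆ M.E, (M.Indep I ↔ LinearIndepOn K v I)

/-- The subspace spanned by the vectors that represent the elements of the flat `F`. -/
def flatSpan (K : Type*) [Field K] {V : Type*} [AddCommGroup V] [Module K V] (v : α → V)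
    (F : M.FlatLattice) : Submodule K V :=
  span K (v '' F.1)

/-- A flat is full if its elements represent all points of the subspace that they span. -/
def IsFullFlat (K : Type*) [Field K] {V : Type*} [AddCommGroup V] [Module K V] (v : α → V)
    (F : M.FlatLattice) : Prop :=
  ∀ u ∈ flatSpan K v F, u ≠ 0 → ∃ x ∈ F.1, u ∈ span K {v x}

theorem mem_of_mem_span_singleton {W : Submodule K V} {u x : V} (hux : u ∈ span K {x})
    (hu : u ∈ W) (hu0 : u ≠ 0) : x ∈ W := by
  by_contra hx
  exact hu0 (disjoint_def.1 (disjoint_span_singleton_of_notMem hx) u hu hux)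

theorem mem_span_singleton_of_mem_span_pair {W : Submodule K V} {p g u y : V} (hp : p ∉ W)
    (hu : u ∈ W) (hy : y ∈ W) (hy0 : y ≠ 0) (hugp : u ∈ span K {g, p})
    (hygp : y ∈ span K {g, p}) : u ∈ span K {y} := by
  have hg : g ∈ span K {y, p} :=
    mem_span_insert_exchange hygp fun hyp ↦ hp (mem_of_mem_span_singleton hyp hy hy0)
  have hle : span K {g, p} ≤ span K {y, p} :=
    span_le.2 (Set.insert_subset hg (Set.singleton_subset_iff.2 (subset_span (by simp))))
  obtain ⟨c, d, hcd⟩ := mem_span_pair.1 (hle hugp)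
  obtain rfl | hd := eq_or_ne d 0
  · exact mem_span_singleton.2 ⟨c, by rw [← hcd, zero_smul, add_zero]⟩
  · have hdp : d • p ∈ W := (W.add_mem_iff_right (W.smul_mem c hy)).1 (hcd ▸ hu)
    exact absurd ((W.smul_mem_iff hd).1 hdp) hp

theorem mem_flatSpan {F : M.FlatLattice} {e : α} (he : e ∈ F.1) : v e ∈ flatSpan K v F :=
  subset_span (Set.mem_image_of_mem v he)

theorem flatSpan_mono {F G : M.FlatLattice} (hFG : F ≤ G) : flatSpan K v F ≤ flatSpan K v G :=
  span_mono (Set.image_mono hFG)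

instance finiteDimensional_flatSpan [M.Finite] (F : M.FlatLattice) :
    FiniteDimensional K (flatSpan K v F) :=
  FiniteDimensional.span_of_finite K ((M.ground_finite.subset F.2.subset_ground).image v)

namespace IsLinearRep

variable {I X : Set α} {e : α}

theorem mem_closure_iff_of_indep (hv : IsLinearRep K M v) (hI : M.Indep I) (he : e ∈ M.E) :
    e ∈ M.closure I ↔ v e ∈ span K (v '' I) := by
  have hlin := (hv I hI.subset_ground).1 hI
  have hmem : e ∈ I → v e ∈ span K (v '' I) := fun h ↦ subset_span (Set.mem_image_of_mem v h)
  rw [hI.mem_closure_iff', hv _ (Set.insert_subset he hI.subset_ground), linearIndepOn_insert_iff]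
  tauto

theorem span_eq_of_isBasis (hv : IsLinearRep K M v) (hI : M.IsBasis I X) :
    span K (v '' I) = span K (v '' X) := by
  refine le_antisymm (span_mono (Set.image_mono hI.subset)) (span_le.2 ?_)
  rintro _ ⟨x, hx, rfl⟩
  exact (hv.mem_closure_iff_of_indep hI.indep (hI.subset_ground hx)).1 (hI.subset_closure hx)

theorem mem_closure_iff (hv : IsLinearRep K M v) (hX : X ⊆ M.E) (he : e ∈ M.E) :
    e ∈ M.closure X ↔ v e ∈ span K (v '' X) := by
  obtain ⟨I, hI⟩ := M.exists_isBasis X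
  rw [← hI.closure_eq_closure, hv.mem_closure_iff_of_indep hI.indep he, hv.span_eq_of_isBasis hI]

theorem mem_flat_iff (hv : IsLinearRep K M v) (F : M.FlatLattice) (he : e ∈ M.E) :
    e ∈ F.1 ↔ v e ∈ flatSpan K v F := by
  rw [flatSpan, ← hv.mem_closure_iff F.2.subset_ground he, F.2.closure]

theorem span_closure (hv : IsLinearRep K M v) (hX : X ⊆ M.E) :
    span K (v '' M.closure X) = span K (v '' X) := by
  refine le_antisymm (span_le.2 ?_) (span_mono (Set.image_mono (M.subset_closure X)))
  rintro _ ⟨x, hx, rfl⟩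
  exact (hv.mem_closure_iff hX (M.closure_subset_ground _ hx)).1 hx

theorem flatSpan_pointFlat (hv : IsLinearRep K M v) (he : e ∈ M.E) :
    flatSpan K v (pointFlat M e) = span K {v e} := by
  rw [flatSpan, pointFlat, hv.span_closure (Set.singleton_subset_iff.2 he), Set.image_singleton]

theorem flatSpan_sup (hv : IsLinearRep K M v) (F G : M.FlatLattice) :
    flatSpan K v (F ⊔ G) = flatSpan K v F ⊔ flatSpan K v G := by
  rw [flatSpan, coe_flat_sup,
    hv.span_closure (Set.union_subset F.2.subset_ground G.2.subset_ground), Set.image_union,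
    span_union, flatSpan, flatSpan]

theorem flatRank_eq_finrank [M.Finite] (hv : IsLinearRep K M v) (F : M.FlatLattice) :
    flatRank M F = Module.finrank K (flatSpan K v F) := by
  obtain ⟨I, hI⟩ := M.exists_isBasis F.1 F.2.subset_ground
  have : Fintype I := (M.ground_finite.subset hI.indep.subset_ground).fintype
  rw [flatSpan, flatRank, hI.eRk_eq_encard, ← hv.span_eq_of_isBasis hI, Set.image_eq_range,
    finrank_span_eq_card ((hv I hI.indep.subset_ground).1 hI.indep), Set.encard,
    ENat.card_eq_coe_fintype_card, ENat.toNat_natCast]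

end IsLinearRep

namespace IsFullFlat

variable {F G H T W : M.FlatLattice} {e : α}

theorem bot (hv : IsLinearRep K M v) : IsFullFlat K v (⊥ : M.FlatLattice) := by
  intro u hu hu0
  rw [flatSpan, coe_flat_bot, hv.span_closure (Set.empty_subset _), Set.image_empty,
    span_empty] at hu
  exact absurd ((mem_bot K).1 hu) hu0

theorem anti (hv : IsLinearRep K M v) (hF : IsFullFlat K v F) (hGF : G ≤ F) :
    IsFullFlat K v G := by
  intro u hu hu0
  obtain ⟨x, hx, hux⟩ := hF u (flatSpan_mono hGF hu) hu0
  have hxG := mem_of_mem_span_singleton hux hu hu0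
  exact ⟨x, (hv.mem_flat_iff G (F.2.subset_ground hx)).2 hxG, hux⟩

theorem flatSpan_inf (hv : IsLinearRep K M v) (hF : IsFullFlat K v F) (G : M.FlatLattice) :
    flatSpan K v (G ⊓ F) = flatSpan K v G ⊓ flatSpan K v F := by
  refine le_antisymm (le_inf (flatSpan_mono inf_le_left) (flatSpan_mono inf_le_right)) ?_
  rintro u ⟨huG, huF⟩
  obtain rfl | hu0 := eq_or_ne u 0
  · exact zero_mem _
  · obtain ⟨x, hx, hux⟩ := hF u huF hu0
    have hxG := (hv.mem_flat_iff G (F.2.subset_ground hx)).2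
      (mem_of_mem_span_singleton hux huG hu0)
    have hxGF : x ∈ (G ⊓ F).1 := ⟨hxG, hx⟩
    exact (span_singleton_le_iff_mem _ _).2 (mem_flatSpan hxGF) hux

theorem isModularBelow [M.Finite] (hv : IsLinearRep K M v) (hF : IsFullFlat K v F)
    (hFW : F ≤ W) : IsModularBelow (flatRank M) W F := by
  refine ⟨hFW, fun G _ ↦ ?_⟩
  rw [hv.flatRank_eq_finrank, hv.flatRank_eq_finrank, hv.flatRank_eq_finrank,
    hv.flatRank_eq_finrank, hF.flatSpan_inf hv, hv.flatSpan_sup, add_comm,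
    finrank_sup_add_finrank_inf_eq]

/-- A vector space is not the union of two proper subspaces. -/
theorem le_or_le (hv : IsLinearRep K M v) (hF : IsFullFlat K v F) (hFGH : F.1 ⊆ G.1 ∪ H.1) :
    F ≤ G ∨ F ≤ H := by
  have hspan : (flatSpan K v F : Set V) ⊆ flatSpan K v G ∪ flatSpan K v H := by
    intro u hu
    obtain rfl | hu0 := eq_or_ne u 0
    · exact .inl (zero_mem _)
    · obtain ⟨x, hx, hux⟩ := hF u hu hu0
      exact (hFGH hx).imp
        (fun hxG ↦ (span_singleton_le_iff_mem _ _).2 (mem_flatSpan hxG) hux)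
        (fun hxH ↦ (span_singleton_le_iff_mem _ _).2 (mem_flatSpan hxH) hux)
  have hle {G : M.FlatLattice} (h : flatSpan K v F ≤ flatSpan K v G) : F ≤ G := fun e he ↦
    (hv.mem_flat_iff G (F.2.subset_ground he)).2 (h (mem_flatSpan he))
  exact (AddSubgroupClass.subset_union.1 hspan).imp hle hle

theorem exists_mem_span_pair (hv : IsLinearRep K M v) (hF : IsFullFlat K v F) (he : e ∈ M.E)
    {u : V} (hu : u ∈ flatSpan K v (F ⊔ pointFlat M e)) (hue : u ∉ span K {v e}) :
    ∃ g ∈ F.1, u ∈ span K {v g, v e} := by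
  rw [hv.flatSpan_sup, hv.flatSpan_pointFlat he] at hu
  obtain ⟨a, ha, b, hb, rfl⟩ := mem_sup.1 hu
  have ha0 : a ≠ 0 := by
    rintro rfl
    exact hue (by rwa [zero_add])
  obtain ⟨g, hg, hag⟩ := hF a ha ha0
  refine ⟨g, hg, ?_⟩
  rw [span_insert]
  exact add_mem (mem_sup_left hag) (mem_sup_right hb)

theorem sup_pointFlat_inf [M.Finite] (hv : IsLinearRep K M v) (hF : IsFullFlat K v F)
    (hT : IsModularBelow (flatRank M) W T) (hWT : flatRank M W = flatRank M T + 1) (hFW : F ≤ W)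
    (heW : e ∈ W.1) (heT : e ∉ T.1) : IsFullFlat K v ((F ⊔ pointFlat M e) ⊓ T) := by
  have heE := W.2.subset_ground heW
  have hveT : v e ∉ flatSpan K v T := fun h ↦ heT ((hv.mem_flat_iff T heE).2 h)
  intro u hu hu0
  have huT : u ∈ flatSpan K v T := flatSpan_mono inf_le_right hu
  have hue : u ∉ span K {v e} := fun h ↦ hveT (mem_of_mem_span_singleton h huT hu0)
  obtain ⟨g, hgF, hug⟩ := hF.exists_mem_span_pair hv heE (flatSpan_mono inf_le_left hu) hue
  have hgE := F.2.subset_ground hgF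
  have hge : g ∉ (pointFlat M e).1 := fun h ↦ hue <| by
    rw [hv.mem_flat_iff _ hgE, hv.flatSpan_pointFlat heE] at h
    exact span_le.2 (Set.pair_subset h (mem_span_singleton_self _)) hug
  obtain ⟨y, ⟨hyl, hyT⟩, hy0⟩ :=
    exists_mem_sup_pointFlat_inf hT hWT heW (hFW hgF) hge heT
  have hyE := T.2.subset_ground hyT
  have hvy0 : v y ≠ 0 := fun h ↦ hy0 ((hv.mem_flat_iff _ hyE).2 (h ▸ zero_mem _))
  have hvy : v y ∈ span K {v g, v e} := by
    rw [span_insert, sup_comm, ← hv.flatSpan_pointFlat heE, ← hv.flatSpan_pointFlat hgE,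
      ← hv.flatSpan_sup]
    exact mem_flatSpan hyl
  have hle : pointFlat M e ⊔ pointFlat M g ≤ F ⊔ pointFlat M e :=
    sup_le le_sup_right (le_sup_of_le_left ((pointFlat_le_iff hgE).2 hgF))
  exact ⟨y, ⟨hle hyl, hyT⟩,
    mem_span_singleton_of_mem_span_pair hveT huT (mem_flatSpan hyT) hvy0 hug hvy⟩

end IsFullFlat

end LinearRepresentations

section ProjectiveGeometries

open Matroid Submodule

variable {α β : Type*} {M : Matroid α} {N : Matroid β}

theorem eRank_le_of_isIsomorphicTo (h : M.IsIsomorphicTo N) : M.eRank ≤ N.eRank := by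
  obtain ⟨φ, hφ⟩ := h
  obtain ⟨B, hB⟩ := M.exists_isBase
  lift B to Set M.E using hB.subset_ground
  rw [← hB.encard_eq_eRank, Subtype.val_injective.encard_image, ← φ.injective.encard_image,
    ← Subtype.val_injective.encard_image]
  exact ((hφ B).1 hB.indep).encard_le_eRank

theorem isSimple_of_isIsomorphicTo (h : M.IsIsomorphicTo N) (hN : N.IsSimple) : M.IsSimple := by
  obtain ⟨φ, hφ⟩ := h
  intro e he f hf
  have hindep := hN _ (φ ⟨e, he⟩).2 _ (φ ⟨f, hf⟩).2
  simpa only [Set.image_pair] using (hφ {⟨e, he⟩, ⟨f, hf⟩}).2 (by simpa only [Set.image_pair])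

namespace HyperplaneArrangement

variable {K V : Type*} [Field K] [AddCommGroup V] [Module K V] [FiniteDimensional K V]

theorem eRank_matroid_le (A : HyperplaneArrangement K V) :
    A.matroid.eRank ≤ Module.finrank K V := by
  obtain ⟨B, hB⟩ := A.matroid.exists_isBase
  have hcodim : Module.finrank K (V ⧸ sInf B) = B.ncard := hB.indep.2
  rw [← hB.encard_eq_eRank, ← (A.matroid.set_finite B hB.subset_ground).cast_ncard_eq, ← hcodim]
  exact_mod_cast finrank_quotient_le _

theorem isSimple_matroid (A : HyperplaneArrangement K V) : A.matroid.IsSimple := by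
  intro H hH H' hH'
  refine ⟨Set.pair_subset hH hH', ?_⟩
  have hcodim := A.codim_eq_one H hH
  have hcodim' := A.codim_eq_one H' hH'
  rw [sInf_pair]
  obtain rfl | hne := eq_or_ne H H'
  · rw [inf_idem, Set.pair_eq_singleton, Set.ncard_singleton, hcodim]
  · rw [Set.ncard_pair hne]
    refine le_antisymm ((codim_inf_le H' H hcodim).trans_eq (by rw [hcodim'])) ?_
    by_contra! hlt
    have hle : H' ≤ H := le_of_codim_inf_eq H' H (by omega)
    have hfinrank := finrank_quotient_add_finrank H
    have hfinrank' := finrank_quotient_add_finrank H'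
    exact hne (eq_of_le_of_finrank_eq hle (by omega)).symm

end HyperplaneArrangement

variable {K U V W : Type*} [Field K] [AddCommGroup U] [Module K U] [FiniteDimensional K U]
  [AddCommGroup V] [Module K V] [AddCommGroup W] [Module K W] [FiniteDimensional K W] {v : α → V}

theorem mem_span_singleton_of_mk {S : Submodule K V} {x y : V} {hx : x ∈ S} {hy : y ∈ S}
    (hxy : (⟨x, hx⟩ : S) ∈ span K {⟨y, hy⟩}) : x ∈ span K {y} := by
  obtain ⟨c, hc⟩ := mem_span_singleton.1 hxy
  exact mem_span_singleton.2 ⟨c, congrArg Subtype.val hc⟩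

theorem dual_mem_span_singleton_of_ker_le {f g : Module.Dual K V}
    (h : LinearMap.ker g ≤ LinearMap.ker f) : f ∈ span K {g} := by
  simpa only [Set.range_const] using
    mem_span_of_iInf_ker_le_ker (L := fun _ : Unit ↦ g) (K := f) (by simpa only [iInf_const])

/-- Embed `W` into the dual of `U`. Taking kernels maps the points of `W` injectively to the
hyperplanes of `U`, and the points `u i` already account for all hyperplanes. -/
theorem exists_mem_span_singleton_of_equiv_hyperplanes {ι : Type*} [Finite ι]
    (φ : ι ≃ {H : Submodule K U // Module.finrank K (U ⧸ H) = 1})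
    (hUW : Module.finrank K W ≤ Module.finrank K U) {u : ι → W} (hu0 : ∀ i, u i ≠ 0)
    (hu : ∀ i j, u i ∈ span K {u j} → i = j) {w : W} (hw : w ≠ 0) :
    ∃ i, w ∈ span K {u i} := by
  rw [← Subspace.dual_finrank_eq (K := K) (V := U)] at hUW
  obtain ⟨g, hg⟩ := finrank_le_iff_exists_linearMap.1 hUW
  have hcodim : ∀ x, x ≠ 0 → Module.finrank K (U ⧸ LinearMap.ker (g x)) = 1 := fun x hx ↦ by
    have hker := Module.Dual.finrank_ker_add_one_of_ne_zero ((map_ne_zero_iff g hg).2 hx)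
    have hquot := finrank_quotient_add_finrank (LinearMap.ker (g x))
    omega
  have hspan : ∀ x y, LinearMap.ker (g y) = LinearMap.ker (g x) → x ∈ span K {y} :=
    fun x y hxy ↦ by
      obtain ⟨c, hc⟩ := mem_span_singleton.1 (dual_mem_span_singleton_of_ker_le hxy.le)
      exact mem_span_singleton.2 ⟨c, hg (by rw [map_smul, hc])⟩
  let hyperplane : ι → {H : Submodule K U // Module.finrank K (U ⧸ H) = 1} := fun i ↦
    ⟨LinearMap.ker (g (u i)), hcodim _ (hu0 i)⟩
  have hinj : Function.Injective hyperplane := fun i j hij ↦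
    hu i j (hspan _ _ (Subtype.ext_iff.1 hij).symm)
  obtain ⟨i, hi⟩ := hinj.surjective_of_finite φ ⟨LinearMap.ker (g w), hcodim w hw⟩
  exact ⟨i, hspan _ _ (Subtype.ext_iff.1 hi)⟩

namespace IsLinearRep

variable {e f : α}

theorem restrict {R : Set α} (hv : IsLinearRep K M v) (hR : R ⊆ M.E) :
    IsLinearRep K (M.restrict R) v := fun I hI ↦ by
  rw [restrict_indep_iff, and_iff_left (show I ⊆ R from hI), hv I (hI.trans hR)]

theorem ne_zero_of_isSimple (hv : IsLinearRep K M v) (hM : M.IsSimple) (he : e ∈ M.E) :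
    v e ≠ 0 :=
  ((hv _ (Set.pair_subset he he)).1 (hM e he e he)).ne_zero (Set.mem_insert _ _)

theorem eq_of_mem_span_singleton (hv : IsLinearRep K M v) (hM : M.IsSimple) (he : e ∈ M.E)
    (hf : f ∈ M.E) (hef : v e ∈ span K {v f}) : e = f := by
  by_contra hne
  have hindep := (hv _ (Set.pair_subset he hf)).1 (hM e he f hf)
  rw [linearIndepOn_insert (Set.notMem_singleton_iff.2 hne), Set.image_singleton] at hindep
  exact hindep.2 hef

end IsLinearRep

theorem isFullFlat_top_of_isIsomorphicTo_projectiveGeometry [Finite K] [M.Finite]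
    (hv : IsLinearRep K M v) {k : ℕ} (hM : M.IsIsomorphicTo (projectiveGeometry K k)) :
    IsFullFlat K v (⊤ : M.FlatLattice) := by
  have hsimple : M.IsSimple :=
    isSimple_of_isIsomorphicTo hM (HyperplaneArrangement.isSimple_matroid _)
  have hrank : Module.finrank K (flatSpan K v (⊤ : M.FlatLattice)) ≤
      Module.finrank K (Fin k → K) := by
    rw [← hv.flatRank_eq_finrank, ← ENat.natCast_le_natCast, coe_flatRank, coe_flat_top,
      eRk_ground]
    exact (eRank_le_of_isIsomorphicTo hM).trans (HyperplaneArrangement.eRank_matroid_le _)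
  let point : M.E → flatSpan K v (⊤ : M.FlatLattice) := fun e ↦ ⟨v e, mem_flatSpan e.2⟩
  have hpoint0 : ∀ e, point e ≠ 0 := fun e h ↦
    hv.ne_zero_of_isSimple hsimple e.2 (congrArg Subtype.val h)
  have hpoint : ∀ e f, point e ∈ span K {point f} → e = f := fun e f hef ↦
    Subtype.ext (hv.eq_of_mem_span_singleton hsimple e.2 f.2 (mem_span_singleton_of_mk hef))
  have : Finite M.E := M.ground_finite.to_subtype
  obtain ⟨φ, -⟩ := hM
  intro u hu hu0
  have hu0' : (⟨u, hu⟩ : flatSpan K v (⊤ : M.FlatLattice)) ≠ 0 := fun h ↦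
    hu0 (congrArg Subtype.val h)
  obtain ⟨e, hue⟩ :=
    exists_mem_span_singleton_of_equiv_hyperplanes φ hrank hpoint0 hpoint hu0'
  exact ⟨e, e.2, mem_span_singleton_of_mk hue⟩

theorem isFullFlat_of_isIsomorphicTo_projectiveGeometry [Finite K] [M.Finite]
    (hv : IsLinearRep K M v) {F : M.FlatLattice} {k : ℕ}
    (hF : (M.restrict F.1).IsIsomorphicTo (projectiveGeometry K k)) : IsFullFlat K v F := by
  have : (M.restrict F.1).Finite := ⟨M.ground_finite.subset F.2.subset_ground⟩
  have htop := isFullFlat_top_of_isIsomorphicTo_projectiveGeometry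
    (hv.restrict F.2.subset_ground) hF
  rwa [IsFullFlat, flatSpan, coe_flat_top, restrict_ground_eq] at htop

end ProjectiveGeometries

section Contractions

open Matroid

variable {α : Type*} {M : Matroid α}

theorem eRk_contract_add_eRk (M : Matroid α) {X Y : Set α} (hX : X ⊆ (M ／ Y).E) (hY : Y ⊆ M.E) :
    (M ／ Y).eRk X + M.eRk Y = M.eRk (X ∪ Y) := by
  obtain ⟨J, hJ⟩ := M.exists_isBasis Y
  obtain ⟨I, hI⟩ := (M ／ Y).exists_isBasis X
  obtain ⟨hIJ, hdisj⟩ := hJ.contract_indep_iff.1 hI.indep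
  have hclosure : M.closure (I ∪ J) = M.closure (I ∪ Y) := by
    rw [← closure_union_closure_right_eq, hJ.closure_eq_closure, closure_union_closure_right_eq]
  have hX_closure : X ⊆ M.closure (I ∪ Y) := by
    have hle := hI.subset_closure
    rw [contract_closure_eq] at hle
    exact hle.trans Set.sdiff_subset
  have hbasis : M.IsBasis (I ∪ J) (X ∪ Y) := by
    rw [isBasis_iff_indep_subset_closure, hclosure]
    exact ⟨hIJ, Set.union_subset_union hI.subset hJ.subset,
      Set.union_subset hX_closure (M.subset_closure_of_subset' Set.subset_union_right hY)⟩
  rw [hI.eRk_eq_encard, hJ.eRk_eq_encard, hbasis.eRk_eq_encard,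
    Set.encard_union_eq (hdisj.symm.mono_right hJ.subset)]

theorem isFlat_union_of_isFlat_contract {G Y : Set α} (hY : Y ⊆ M.E) (hG : (M ／ Y).IsFlat G) :
    M.IsFlat (G ∪ Y) := by
  have hY_closure : Y ⊆ M.closure (G ∪ Y) :=
    M.subset_closure_of_subset' Set.subset_union_right hY
  have hclosure : M.closure (G ∪ Y) = G ∪ Y := by
    conv_rhs => rw [← hG.closure, contract_closure_eq, Set.sdiff_union_of_subset hY_closure]
  exact hclosure ▸ M.isFlat_closure _

theorem isFlat_contract_sdiff {F Y : Set α} (hF : M.IsFlat F) (hYF : Y ⊆ F) :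
    (M ／ Y).IsFlat (F \ Y) := by
  rw [isFlat_iff_closure_eq, contract_closure_eq, Set.sdiff_union_of_subset hYF, hF.closure]

/-- The order embedding of the lattice of flats of `M ／ Y` onto the interval `[Y, E]` of the
lattice of flats of `M`. -/
def uncontractFlat (Y : M.FlatLattice) : (M ／ Y.1).FlatLattice ↪o M.FlatLattice :=
  OrderEmbedding.ofMapLEIff
    (fun G ↦ ⟨G.1 ∪ Y.1, isFlat_union_of_isFlat_contract Y.2.subset_ground G.2⟩)
    fun G _ ↦ ⟨fun h _ he ↦ (h (.inl he)).resolve_right (G.2.subset_ground he).2,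
      fun h ↦ Set.union_subset_union_left _ h⟩

theorem coe_uncontractFlat (Y : M.FlatLattice) (G : (M ／ Y.1).FlatLattice) :
    (uncontractFlat Y G).1 = G.1 ∪ Y.1 := rfl

theorem uncontractFlat_bot (Y : M.FlatLattice) : uncontractFlat Y ⊥ = Y := by
  refine Subtype.ext ?_
  rw [coe_uncontractFlat, coe_flat_bot, contract_closure_eq, Set.empty_union, Y.2.closure,
    Set.sdiff_self, Set.empty_union]

theorem uncontractFlat_top (Y : M.FlatLattice) : uncontractFlat Y ⊤ = ⊤ :=
  Subtype.ext (Set.sdiff_union_of_subset Y.2.subset_ground)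

theorem exists_uncontractFlat_eq {Y F : M.FlatLattice} (hYF : Y ≤ F) :
    ∃ G, uncontractFlat Y G = F :=
  ⟨⟨F.1 \ Y.1, isFlat_contract_sdiff F.2 hYF⟩, Subtype.ext (Set.sdiff_union_of_subset hYF)⟩

theorem isIccIso_uncontractFlat (Y : M.FlatLattice) : IsIccIso (uncontractFlat Y) ⊥ ⊤ where
  le_iff_le _ _ _ _ := (uncontractFlat Y).le_iff_le
  surjOn F hF := by
    rw [uncontractFlat_bot] at hF
    obtain ⟨G, rfl⟩ := exists_uncontractFlat_eq hF.1
    exact ⟨G, ⟨bot_le, le_top⟩, rfl⟩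

variable [M.Finite]

theorem flatRank_uncontractFlat (Y : M.FlatLattice) (G : (M ／ Y.1).FlatLattice) :
    flatRank M (uncontractFlat Y G) = flatRank (M ／ Y.1) G + flatRank M Y := by
  rw [← ENat.natCast_inj]
  push_cast
  rw [coe_flatRank, coe_flatRank, coe_flatRank, coe_uncontractFlat,
    eRk_contract_add_eRk M G.2.subset_ground Y.2.subset_ground]

theorem charPoly_eq_intervalCharPoly (M : Matroid α) [M.Finite] :
    M.charPoly = intervalCharPoly (flatRank M) ⊥ ⊤ := by
  rw [charPoly, intervalCharPoly, Finset.Icc_bot_top]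
  refine Finset.sum_congr rfl fun F _ ↦ ?_
  rw [flatMobius, flatRank, flatRank, coe_flat_top, eRk_ground,
    ENat.toNat_sub (eRk_ne_top_iff.2 (M.isRkFinite_set _))]
  congr!

theorem charPoly_contract (Y : M.FlatLattice) :
    (M ／ Y.1).charPoly = intervalCharPoly (flatRank M) Y ⊤ := by
  rw [charPoly_eq_intervalCharPoly, (isIccIso_uncontractFlat Y).intervalCharPoly_eq bot_le
    fun G _ ↦ ?_, uncontractFlat_bot, uncontractFlat_top]
  rw [flatRank_uncontractFlat, flatRank_uncontractFlat, Nat.add_sub_add_right]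

end Contractions

section DivisionalFlags

open Matroid Relation

theorem exists_seq_of_reflTransGen {L : Type*} {r : L → L → Prop} {a b : L}
    (h : ReflTransGen r a b) :
    ∃ (n : ℕ) (f : ℕ → L), f 0 = a ∧ f n = b ∧ ∀ i < n, r (f i) (f (i + 1)) := by
  induction h using ReflTransGen.head_induction_on with
  | refl => exact ⟨0, fun _ ↦ b, rfl, rfl, fun i hi ↦ absurd hi i.not_lt_zero⟩
  | @head a _ hac _ ih =>
    obtain ⟨n, f, rfl, hn, hf⟩ := ih
    refine ⟨n + 1, fun i ↦ i.casesOn a f, rfl, hn, fun i hi ↦ ?_⟩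
    cases i with
    | zero => exact hac
    | succ i => exact hf i (Nat.succ_lt_succ_iff.1 hi)

theorem hasDivisionalFlag_of_reflTransGen {α : Type*} {M : Matroid α} [M.Finite]
    (hM : M.closure ∅ = ∅) (h : ReflTransGen (DivisionalStep (flatRank M) ⊤) ⊥ ⊤) :
    M.HasDivisionalFlag := by
  obtain ⟨n, f, h0, hn, hf⟩ := exists_seq_of_reflTransGen h
  have hrank : ∀ i ≤ n, flatRank M (f i) = i := by
    intro i hi
    induction i with
    | zero => rw [h0, (isSemimodularRank_flatRank M).bot]
    | succ i ih => rw [(hf i hi).rank, ih (Nat.le_of_succ_le hi)]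
  refine ⟨n, fun i ↦ (f i).1, ⟨fun i ↦ (f i).2, ?_, ?_, ?_, fun i ↦ ?_⟩, fun i ↦ ?_⟩
  · rw [Fin.val_zero, h0, coe_flat_bot, hM]
  · rw [Fin.val_last, hn, coe_flat_top]
  · exact Fin.monotone_iff_le_succ.2 fun i ↦ (hf i i.2).le
  · rw [← coe_flatRank, hrank i (Nat.lt_succ_iff.1 i.2)]
  · rw [charPoly_contract, charPoly_contract]
    exact (hf i i.2).dvd

end DivisionalFlags

section ModularJoinClass

open Matroid

variable {α : Type*} {M : Matroid α} {T F : Set α}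

theorem isFlat_of_isFlat_restrict (hT : M.IsFlat T) (hF : (M.restrict T).IsFlat F) :
    M.IsFlat F := by
  have hFT : F ⊆ T := hF.subset_ground
  rw [isFlat_iff_closure_eq, ← Set.inter_eq_left.2 (closure_subset_of_isFlat hT hFT),
    ← M.restrict_closure_eq hFT hT.subset_ground, hF.closure]

theorem isFlat_restrict_of_subset (hT : M.IsFlat T) (hF : M.IsFlat F) (hFT : F ⊆ T) :
    (M.restrict T).IsFlat F := by
  rw [isFlat_iff_closure_eq, M.restrict_closure_eq hFT hT.subset_ground, hF.closure,
    Set.inter_eq_left.2 hFT]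

theorem isModularBelow_of_isModularFlat_restrict [M.Finite] {T F : M.FlatLattice}
    (hF : (M.restrict T.1).IsModularFlat F.1) : IsModularBelow (flatRank M) T F := by
  have hFT : F.1 ⊆ T.1 := hF.1.subset_ground
  refine ⟨hFT, fun G (hGT : G.1 ⊆ T.1) ↦ ?_⟩
  have hclosure := closure_subset_of_isFlat T.2 (Set.union_subset hGT hFT)
  have hmod := hF.2 G.1 (isFlat_restrict_of_subset T.2 G.2 hGT)
  rw [M.restrict_closure_eq (Set.union_subset hFT hGT) T.2.subset_ground, Set.union_comm,
    Set.inter_eq_left.2 hclosure, Set.inter_comm, M.restrict_eRk_eq hFT, M.restrict_eRk_eq hGT,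
    M.restrict_eRk_eq (Set.inter_subset_left.trans hGT), M.restrict_eRk_eq hclosure] at hmod
  rw [← ENat.natCast_inj]
  push_cast
  rw [coe_flatRank, coe_flatRank, coe_flatRank, coe_flatRank, add_comm (M.eRk G.1)]
  exact hmod.symm

theorem closure_empty_of_isSimple (hM : M.IsSimple) : M.closure ∅ = ∅ := by
  refine Set.eq_empty_iff_forall_notMem.2 fun e he ↦ ?_
  have hloop : M.IsLoop e := he
  have hpair := hM e hloop.mem_ground e hloop.mem_ground
  exact hloop.not_indep_of_mem (Set.mem_insert e {e}) hpair

namespace MemJoinClass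

variable {K : Type*} [Field K] [Finite K]

theorem isRepresentableOver (hM : MemJoinClass K M) :
    M.IsRepresentableOver K := by
  cases hM <;> assumption

theorem isSimple (hM : MemJoinClass K M) : M.IsSimple := by
  cases hM with
  | supersolvable _ _ _ hss => exact hss.1
  | modularJoin _ _ _ _ _ hjoin => exact hjoin.isSimple

end MemJoinClass

variable {K V : Type*} [Field K] [AddCommGroup V] [Module K V] [M.Finite] {v : α → V}
  {T X : M.FlatLattice}

theorem IsFullFlat.hasDivisionalComplement_of_modular_chain (hv : IsLinearRep K M v)
    {n : ℕ} {c : ℕ → M.FlatLattice} (hc : Monotone c) (hrank : ∀ i ≤ n, flatRank M (c i) = i)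
    (hmod : ∀ i ≤ n, IsModularBelow (flatRank M) (c n) (c i)) (hX : IsFullFlat K v X)
    (hXc : X ≤ c n) : HasDivisionalComplement (flatRank M) (c n) X := by
  have hρ := isSemimodularRank_flatRank M
  induction n generalizing X with
  | zero =>
    have hXeq : X = c 0 := hρ.eq_of_le_of_rank_le hXc (by rw [hrank 0 le_rfl]; exact Nat.zero_le _)
    exact hXeq ▸ .self hρ X
  | succ n ih =>
    have hcle : c n ≤ c (n + 1) := hc n.le_succ
    have ih' : ∀ {Y}, IsFullFlat K v Y → Y ≤ c n → HasDivisionalComplement (flatRank M) (c n) Y :=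
      ih (fun i hi ↦ hrank i (hi.trans n.le_succ)) fun i hi ↦
        (hmod i (hi.trans n.le_succ)).mono (hc hi) hcle
    have hmodn := hmod n n.le_succ
    have hrankn : flatRank M (c (n + 1)) = flatRank M (c n) + 1 := by
      rw [hrank _ le_rfl, hrank _ n.le_succ]
    by_cases hcover : (c (n + 1)).1 ⊆ (c n).1 ∪ X.1
    · exact .of_isModularJoinBelow hρ
        (isModularJoinBelow_of_subset_union hmodn (hX.isModularBelow hv hXc) hcover) le_rfl
        (ih' (hX.anti hv inf_le_right) inf_le_left) (.self hρ X)
    · obtain ⟨e, hec, he⟩ := Set.not_subset.1 hcover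
      obtain ⟨hen, heX⟩ := not_or.1 he
      have heE := (c (n + 1)).2.subset_ground hec
      exact .of_coatom hρ hmodn hrankn hXc ((pointFlat_le_iff heE).2 hec)
        (flatRank_pointFlat heE heX) (mt (pointFlat_le_iff heE).1 hen)
        (mt (pointFlat_le_iff heE).1 heX)
        (ih' (hX.sup_pointFlat_inf hv hmodn hrankn hXc hec hen) inf_le_right)

theorem IsFullFlat.hasDivisionalComplement_of_isSupersolvable (hv : IsLinearRep K M v)
    (hT : (M.restrict T.1).IsSupersolvable) (hX : IsFullFlat K v X) (hXT : X ≤ T) :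
    HasDivisionalComplement (flatRank M) T X := by
  obtain ⟨-, n, Y, hY, hmod⟩ := hT
  let c (i : ℕ) : M.FlatLattice :=
    ⟨Y ⟨min i n, Nat.lt_succ_of_le (min_le_right i n)⟩, isFlat_of_isFlat_restrict T.2 (hY.isFlat _)⟩
  have hc : Monotone c := fun i j hij ↦ hY.mono (Fin.mk_le_mk.2 (min_le_min_right n hij))
  have hcT : c n = T := by
    refine Subtype.ext ((congrArg Y (a₂ := Fin.last n) (Fin.ext (min_self n))).trans ?_)
    rw [hY.last, restrict_ground_eq]
  have hrank : ∀ i ≤ n, flatRank M (c i) = i := fun i hi ↦ by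
    have hYi := hY.rank ⟨min i n, Nat.lt_succ_of_le (min_le_right i n)⟩
    rw [M.restrict_eRk_eq (R := T.1) (hY.isFlat _).subset_ground] at hYi
    rw [← ENat.natCast_inj, coe_flatRank, hYi, Fin.val_mk, min_eq_left hi]
  rw [← hcT] at hXT ⊢
  exact hX.hasDivisionalComplement_of_modular_chain hv hc hrank
    (fun i _ ↦ hcT.symm ▸ isModularBelow_of_isModularFlat_restrict (hmod _)) hXT

namespace MemJoinClass

theorem hasDivisionalComplement [Finite K] (hv : IsLinearRep K M v)
    (hT : MemJoinClass K (M.restrict T.1)) (hX : IsFullFlat K v X) (hXT : X ≤ T) :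
    HasDivisionalComplement (flatRank M) T X := by
  have hρ := isSemimodularRank_flatRank M
  generalize hN : M.restrict T.1 = N at hT
  induction hT generalizing T X with
  | supersolvable N _ _ hss =>
    exact hX.hasDivisionalComplement_of_isSupersolvable hv (hN ▸ hss) hXT
  | modularJoin N _ _ E₁ E₂ hjoin k hPG _ _ ih₁ ih₂ =>
    subst hN
    obtain ⟨T₁, rfl⟩ : ∃ T₁ : M.FlatLattice, T₁.1 = E₁ :=
      ⟨⟨E₁, isFlat_of_isFlat_restrict T.2 hjoin.modular_left.1⟩, rfl⟩
    obtain ⟨T₂, rfl⟩ : ∃ T₂ : M.FlatLattice, T₂.1 = E₂ :=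
      ⟨⟨E₂, isFlat_of_isFlat_restrict T.2 hjoin.modular_right.1⟩, rfl⟩
    have hT₁ := isModularBelow_of_isModularFlat_restrict hjoin.modular_left
    have hT₂ := isModularBelow_of_isModularFlat_restrict hjoin.modular_right
    have hunion : T.1 ⊆ T₁.1 ∪ T₂.1 := hjoin.union_eq.superset
    rw [M.restrict_restrict_eq (Set.inter_subset_left.trans hT₁.le)] at hPG
    have hres₁ := (M.restrict_restrict_eq hT₁.le).symm
    have hres₂ := (M.restrict_restrict_eq hT₂.le).symm
    have hjoinT := isModularJoinBelow_of_subset_union hT₁ hT₂ hunion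
    have hmeet := isFullFlat_of_isIsomorphicTo_projectiveGeometry hv (F := T₁ ⊓ T₂) hPG
    obtain hX₁ | hX₂ := hX.le_or_le hv (Set.Subset.trans hXT hunion)
    · exact .of_isModularJoinBelow hρ hjoinT.symm hX₁
        (ih₂ (hmeet.anti hv (inf_comm ..).le) inf_le_left hres₂) (ih₁ hX hX₁ hres₁)
    · exact .of_isModularJoinBelow hρ hjoinT hX₂ (ih₁ hmeet inf_le_left hres₁)
        (ih₂ hX hX₂ hres₂)

end MemJoinClass

end ModularJoinClass

theorem mainTheorem5_general {K α : Type*} [Field K] [Finite K] {M : Matroid α} [M.Finite]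
    (hM : MemJoinClass K M) : M.HasDivisionalFlag := by
  obtain ⟨n, v, hv⟩ := hM.isRepresentableOver
  have hρ := isSemimodularRank_flatRank M
  have hM_top : MemJoinClass K (M.restrict (⊤ : M.FlatLattice).1) := by
    rwa [coe_flat_top, M.restrict_ground_eq_self]
  obtain ⟨z, hz, hchain, -, hrank⟩ :=
    hM_top.hasDivisionalComplement hv (IsFullFlat.bot hv) bot_le
  have hz_top : z = ⊤ := hρ.eq_of_le_of_rank_le hz (by rw [← hrank, hρ.bot, add_zero])
  exact hasDivisionalFlag_of_reflTransGen (closure_empty_of_isSimple hM.isSimple)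
    (hz_top ▸ hchain)

theorem mainTheorem5 {K V : Type*} [Field K] [Finite K] [AddCommGroup V] [Module K V]
    [FiniteDimensional K V] (A : HyperplaneArrangement K V)
    (hA : MemJoinClass K A.matroid) : A.IsDivisionallyFree :=
  mainTheorem5_general hA
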